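/- For $n\ge 1$ put $q=1+\lfloor\log_2 n\rfloor$. Let $V$ be the following circuit of multi-controlled NOT gates on a row register $r_1,\dots,r_n$, a column register $c_1,\dots,c_n$, an AND qubit, a $q$-qubit volume register, a $q$-qubit parameter register and a phase qubit. 1. For $i=1,\dots,n$ in turn: a Toffoli gate with controls $r_i,c_i$ and target the AND qubit; the gate INCR on the volume register, controlled by the AND qubit; the same Toffoli gate again. 2. CNOT gates from each qubit of the volume register to the corresponding qubit of the parameter register. 3. A multi-controlled NOT gate that flips the phase qubit if and only if all qubits of the parameter register are $0$ (a $\mathrm{C}^{q}\mathrm{NOT}$ gate with Pauli-$X$ gates on all its controls before and after it). 4. Uncomputation: step 2 again, and then, for $i=n,\dots,1$ in turn, the Toffoli gate of $i$, the gate DECR on the volume register controlled by the AND qubit, and the Toffoli gate of $i$ again. Here INCR is the sequence of multi-controlled NOT gates that, for $i=q-1,\dots,1,0$ in this order, flips the bit of significance $2^i$ if all bits of lower significance are $1$; DECR is the same sequence in the opposite order; in their controlled versions every gate has the additional control. For an integer $k\ge 0$ with $k+2<2^{q}$ (so that $k+2$ fits into the parameter register), the oracle circuit $V_k$ is $V$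 with the ancilla qubits (all qubits except the two data registers) prepared in the state $|0\rangle|0\cdots0\rangle|k+2\rangle|-\rangle$, where $|-\rangle=(|0\rangle-|1\rangle)/\sqrt2$. Then the following hold. (a) For every $n\ge1$ the circuit has $2(\lfloor\log_2 n\rfloor+2)$ ancilla qubits, and its total width is $2(n+\lfloor\log_2 n\rfloor+2)$ qubits. (b) For all $n\ge1$, all $k$ as above and all $\mathbf r,\mathbf c\in\{0,1\}^n$, with $s=-1$ if $\mathbf r\cdot\mathbf c=\sum_i r_ic_i=k+2$ and $s=1$ otherwise, $$V\,|\mathbf r\rangle|\mathbf c\rangle|0\rangle|0\cdots0\rangle|k+2\rangle|-\rangle = s\,|\mathbf r\rangle|\mathbf c\rangle|0\rangle|0\cdots0\rangle|k+2\rangle|-\rangle .$$ (c) For every $n\ge 1$ one can replace each multi-controlled NOT gate of $V$ by a sequence of single-qubit unitary gates and CNOT gates on the same $2(n+\lfloor\log_2 n\rfloor+2)$ qubits that implements exactly the same unitary, in such a way that the depth of the resulting circuit of single-qubit and CNOT gates is $O\bigl(n\log(n)\,(\log\log n)^3\bigr)$ as $n\to\infty$. -/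

import Mathlib

open Asymptotics Filter

namespace BDOracle

section Gates

variable {Q : Type} [Fintype Q] [DecidableEq Q]

/-- An `m`-controlled NOT gate on the qubits `Q`, where `m` is the number of elements of `controls`:
`m = 0` is the Pauli-X gate, `m = 1` the CNOT gate, `m = 2` the Toffoli gate. -/
structure MCX (Q : Type) where
  controls : Finset Q
  target : Q
  target_notMem : target ∉ controls

/-- The action on computational basis states (bit strings indexed by the qubits): flip the target
bit if and only if all control bits are `1`. -/
def MCX.act (g : MCX Q) (x : Q → Bool) : Q → Bool :=
  if ∀ c ∈ g.controls, x c = true then Function.update x g.target (!x g.target) else x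

/-- The matrix of a multi-controlled NOT gate in the computational basis. -/
def MCX.matrix (g : MCX Q) : Matrix (Q → Bool) (Q → Bool) ℂ :=
  Matrix.of fun y x => if y = g.act x then 1 else 0

/-- The Pauli-X gate. -/
def xGate (t : Q) : MCX Q := ⟨∅, t, by simp⟩

/-- The CNOT gate. -/
def cxGate (c t : Q) (h : t ≠ c) : MCX Q := ⟨{c}, t, by simpa using h⟩

/-- The primitive gates: arbitrary single-qubit unitary gates, and CNOT gates. -/
inductive PrimGate (Q : Type) where
  | single (q : Q) (u : Matrix.unitaryGroup Bool ℂ)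
  | cnot (c t : Q) (h : t ≠ c)

/-- The matrix of a primitive gate on all qubits; a single-qubit gate acts as the identity on the
other qubits. -/
noncomputable def PrimGate.matrix : PrimGate Q → Matrix (Q → Bool) (Q → Bool) ℂ
  | .single q u => Matrix.of fun y x =>
      if ∀ p, p ≠ q → y p = x p then (u : Matrix Bool Bool ℂ) (y q) (x q) else 0
  | .cnot c t h => (cxGate c t h).matrix

/-- The qubits on which a primitive gate acts. -/
def PrimGate.support : PrimGate Q → Finset Q
  | .single q _ => {q}
  | .cnot c t _ => {c, t}

/-- The matrix of a sequence of gates; the head of the list is applied first. -/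
noncomputable def circuitMatrix {G : Type} (mat : G → Matrix (Q → Bool) (Q → Bool) ℂ) :
    List G → Matrix (Q → Bool) (Q → Bool) ℂ
  | [] => 1
  | g :: C => circuitMatrix mat C * mat g

/-- Scheduling each gate as early as possible: if `t q` is the number of time steps after which the
qubit `q` is free, then `busyUntil C t q` is this number after the gates of `C` have been added.
Gates that act on disjoint sets of qubits may share a time step. -/
def busyUntil : List (PrimGate Q) → (Q → ℕ) → Q → ℕ
  | [], t => t
  | g :: C, t => busyUntil C fun q => if q ∈ g.support then g.support.sup t + 1 else t q

/-- The depth of a circuit of primitive gates. -/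
def depth (C : List (PrimGate Q)) : ℕ := Finset.univ.sup (busyUntil C fun _ => 0)

/-- `W` arises from the circuit `V` of multi-controlled NOT gates by replacing every single gate by
a sequence of primitive gates on the same set of qubits `Q` with exactly the same matrix.
(Qubits outside of the replaced gate may be borrowed, in any state, and are given back.) -/
def IsDecomposition (W : List (PrimGate Q)) (V : List (MCX Q)) : Prop :=
  ∃ blocks : List (List (PrimGate Q)),
    List.Forall₂ (fun g b => circuitMatrix PrimGate.matrix b = MCX.matrix g) V blocks ∧
      W = blocks.flatten

/-- The computational basis vector `|x⟩`. -/
def ket (x : Q → Bool) : (Q → Bool) → ℂ := Pi.single x 1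

/-- The increment gate `INCR` of a register of `m` qubits, controlled by a further qubit `a`. Here
`reg j` is the bit of significance `2 ^ j`. `INCR` itself is the following circuit: for
`i = m - 1, …, 1, 0` in this order, flip bit `i` if all bits of lower significance are `1`; the
controlled version has `a` as an additional control of every gate. -/
def ctrlIncr {m : ℕ} (a : Q) (reg : Fin m ↪ Q) (h : ∀ j, reg j ≠ a) : List (MCX Q) :=
  (List.finRange m).reverse.map fun i =>
    ⟨insert a ((Finset.univ.filter fun j => j < i).map reg), reg i, by simp [h i]⟩

/-- The controlled decrement gate `DECR`: the gates of the controlled `INCR` in the opposite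
order. -/
def ctrlDecr {m : ℕ} (a : Q) (reg : Fin m ↪ Q) (h : ∀ j, reg j ≠ a) : List (MCX Q) :=
  (ctrlIncr a reg h).reverse

end Gates

/-- The number `1 + ⌊log₂ n⌋` of qubits of each of the two integer registers. -/
abbrev regSize (n : ℕ) : ℕ := 1 + Nat.log 2 n

/-- The data qubits: the row register and the column register. -/
abbrev DataQubit (n : ℕ) : Type := Fin n ⊕ Fin n

/-- The ancilla qubits: AND qubit, volume register, parameter register, phase qubit. -/
abbrev AncillaQubit (n : ℕ) : Type := (Unit ⊕ Fin (regSize n)) ⊕ (Fin (regSize n) ⊕ Unit)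

/-- All qubits of the oracle circuit. -/
abbrev OracleQubit (n : ℕ) : Type := DataQubit n ⊕ AncillaQubit n

section Oracle

variable (n : ℕ)

def row (i : Fin n) : OracleQubit n := .inl (.inl i)
def col (i : Fin n) : OracleQubit n := .inl (.inr i)
def andQubit : OracleQubit n := .inr (.inl (.inl ()))
def phaseQubit : OracleQubit n := .inr (.inr (.inr ()))

def vol : Fin (regSize n) ↪ OracleQubit n :=
  ⟨fun j => .inr (.inl (.inr j)), fun a b h => by simpa using h⟩

def par : Fin (regSize n) ↪ OracleQubit n :=
  ⟨fun j => .inr (.inr (.inl j)), fun a b h => by simpa using h⟩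

/-- The Toffoli gate that adds `rᵢ AND cᵢ` to the AND qubit. -/
def andGate (i : Fin n) : MCX (OracleQubit n) :=
  ⟨{row n i, col n i}, andQubit n, by simp [row, col, andQubit]⟩

theorem vol_ne_andQubit (j : Fin (regSize n)) : vol n j ≠ andQubit n := by
  intro h
  cases h

/-- Write the dot product to the volume register: for `i = 0, …, n - 1`, compute `rᵢ AND cᵢ` in the
AND qubit, increment the volume register if it is `1`, and clear the AND qubit again. -/
def countStage : List (MCX (OracleQubit n)) :=
  (List.finRange n).flatMap fun i =>
    [andGate n i] ++ ctrlIncr (andQubit n) (vol n) (vol_ne_andQubit n) ++ [andGate n i]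

/-- Add (bitwise, modulo 2) the volume register to the parameter register by CNOT gates. -/
def compareStage : List (MCX (OracleQubit n)) :=
  (List.finRange (regSize n)).reverse.map fun j =>
    cxGate (vol n j) (par n j) (by intro h; cases h)

/-- Pauli-X gates on all qubits of the parameter register. -/
def flipPar : List (MCX (OracleQubit n)) :=
  (List.finRange (regSize n)).map fun j => xGate (par n j)

/-- Flip the phase qubit if all qubits of the parameter register are `0`: a multi-controlled NOT
gate whose controls are reversed by Pauli-X gates. -/
def markStage : List (MCX (OracleQubit n)) :=
  flipPar n ++ [⟨Finset.univ.map (par n), phaseQubit n,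
    by rw [Finset.mem_map]; rintro ⟨j, -, h⟩; cases h⟩] ++ flipPar n

/-- Return the volume register to zero, for `i = n - 1, …, 0`, by controlled decrements. -/
def uncountStage : List (MCX (OracleQubit n)) :=
  (List.finRange n).reverse.flatMap fun i =>
    [andGate n i] ++ ctrlDecr (andQubit n) (vol n) (vol_ne_andQubit n) ++ [andGate n i]

/-- The oracle circuit. Its gates do not depend on `k`, which enters through the initial state of
the parameter register. -/
def oracleCircuit : List (MCX (OracleQubit n)) :=
  countStage n ++ compareStage n ++ markStage n ++ (compareStage n).reverse ++ uncountStage n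

/-- The bit string with row `r`, column `c`, AND qubit `0`, volume register `0 … 0`, parameter
register the binary representation of `s`, and phase qubit `p`. -/
def inputBits (s : ℕ) (r c : Fin n → Bool) (p : Bool) : OracleQubit n → Bool
  | .inl (.inl i) => r i
  | .inl (.inr i) => c i
  | .inr (.inl (.inl ())) => false
  | .inr (.inl (.inr _)) => false
  | .inr (.inr (.inl j)) => s.testBit j
  | .inr (.inr (.inr ())) => p

/-- The state `|r⟩ |c⟩ |0⟩ |0 … 0⟩ |k + 2⟩ |-⟩`, where `|-⟩ = (|0⟩ - |1⟩) / √2`. -/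
noncomputable def inputState (k : ℕ) (r c : Fin n → Bool) : (OracleQubit n → Bool) → ℂ :=
  ((1 / Real.sqrt 2 : ℝ) : ℂ) •
    (ket (inputBits n (k + 2) r c false) - ket (inputBits n (k + 2) r c true))

/-- The dot product `∑ᵢ rᵢ cᵢ` of two bit strings, as a natural number. -/
def dotBits (r c : Fin n → Bool) : ℕ := ∑ i, (r i).toNat * (c i).toNat

end Oracle

end BDOracle

open BDOracle

set_option linter.unusedSectionVars false

/-! Correctness is a statement about bit strings: every gate permutes the basis states, so the
circuit is the matrix of the map `run` (`circuitMatrix_run`). The gates before the marking compute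
r·c and compare it with k + 2; those after it are the same gates in reverse order, hence the
inverse, since each gate is an involution. The marking changes only the phase qubit, which controls
nothing. So the circuit adds the truth value of r·c = k + 2 to the phase qubit
(`oracleCircuit_run`), and |-⟩ turns this flip into the sign.

For the depth, V has O(n log n) gates with at most q = O(log n) controls each (or two), so depth
O((log log n)³) per gate suffices, even if the gates run one after another. The core is a
square-root recursion (`implements_mcx`): a gate with b² controls costs eight rounds of gates with
at most b controls, plus a constant. Some of the controls temporarily store conjunctions of groups
of other controls, all groups in parallel, and one borrowed qubit in an unknown state makes the
scheme exact (`mcx_eq_borrow`). About log log q levels give 8 ^ (log log q) = (log q)³. The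
recursion ends at the Toffoli gate, built exactly from Hadamard, T and CNOT gates.

The borrowed qubits are the 2n data qubits: a gate with more than two controls never touches them
(`card_controls_of_mem_oracleCircuit`). -/

namespace BDOracle

/-! ### Multi-controlled NOT gates on bit strings -/

section Semantics

variable {Q : Type} [Fintype Q] [DecidableEq Q]

/-- Add the bit `b` to the bit of `x` at `t`. -/
def toggle (t : Q) (b : Bool) (x : Q → Bool) : Q → Bool := Function.update x t (x t ^^ b)

/-- The conjunction of the bits of `x` in `S`. -/
def allOn (S : Finset Q) (x : Q → Bool) : Bool := decide (∀ c ∈ S, x c = true)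

/-- Add the conjunction of the bits in `S` to the bit at `t`. -/
def mcx (S : Finset Q) (t : Q) (x : Q → Bool) : Q → Bool := toggle t (allOn S x) x

@[simp] theorem toggle_same (t : Q) (b : Bool) (x : Q → Bool) : toggle t b x t = (x t ^^ b) := by
  simp [toggle]

theorem toggle_of_ne {p t : Q} (h : p ≠ t) (b : Bool) (x : Q → Bool) : toggle t b x p = x p := by
  simp [toggle, h]

@[simp] theorem toggle_false (t : Q) (x : Q → Bool) : toggle t false x = x := by
  simp [toggle]

theorem toggle_apply (t : Q) (b : Bool) (x : Q → Bool) (p : Q) :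
    toggle t b x p = (x p ^^ (decide (p = t) && b)) := by
  by_cases h : p = t
  · subst h; simp
  · simp [toggle_of_ne h, h]

theorem toggle_toggle (t : Q) (b b' : Bool) (x : Q → Bool) :
    toggle t b (toggle t b' x) = toggle t (b' ^^ b) x := by
  ext p
  simp only [toggle_apply]
  cases decide (p = t) <;> simp

theorem toggle_comm (s t : Q) (b b' : Bool) (x : Q → Bool) :
    toggle s b (toggle t b' x) = toggle t b' (toggle s b x) := by
  ext p
  simp only [toggle_apply, Bool.xor_assoc]
  rw [Bool.xor_comm (decide (p = t) && b')]

theorem allOn_congr {S : Finset Q} {x y : Q → Bool} (h : ∀ c ∈ S, x c = y c) :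
    allOn S x = allOn S y := by
  unfold allOn
  congr 1
  exact propext (forall₂_congr fun c hc => by rw [h c hc])

theorem allOn_toggle {S : Finset Q} {t : Q} (h : t ∉ S) (b : Bool) (x : Q → Bool) :
    allOn S (toggle t b x) = allOn S x :=
  allOn_congr fun _ hc => toggle_of_ne (ne_of_mem_of_not_mem hc h) b x

theorem allOn_insert (a : Q) (S : Finset Q) (x : Q → Bool) :
    allOn (insert a S) x = (x a && allOn S x) := by
  simp [allOn]

theorem mcx_mcx {S : Finset Q} {t : Q} (h : t ∉ S) (x : Q → Bool) : mcx S t (mcx S t x) = x := by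
  simp [mcx, allOn_toggle h, toggle_toggle]

theorem MCX.act_eq_mcx (g : MCX Q) : g.act = mcx g.controls g.target := by
  funext x
  unfold MCX.act mcx allOn toggle
  split_ifs with h
  · rw [decide_eq_true h, Bool.xor_true]
  · rw [decide_eq_false h, Bool.xor_false, Function.update_eq_self]

/-- The action of a circuit of multi-controlled NOT gates on bit strings. -/
def run (C : List (MCX Q)) (x : Q → Bool) : Q → Bool := C.foldl (fun y g => g.act y) x

@[simp] theorem run_nil (x : Q → Bool) : run [] x = x := rfl

@[simp] theorem run_cons (g : MCX Q) (C : List (MCX Q)) (x : Q → Bool) :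
    run (g :: C) x = run C (mcx g.controls g.target x) := by
  simp [run, MCX.act_eq_mcx]

theorem run_append (C C' : List (MCX Q)) (x : Q → Bool) : run (C ++ C') x = run C' (run C x) := by
  simp [run]

theorem run_reverse_run (C : List (MCX Q)) (x : Q → Bool) : run C.reverse (run C x) = x := by
  induction C generalizing x with
  | nil => rfl
  | cons g C ih => simp [run_append, ih, mcx_mcx g.target_notMem]

end Semantics

/-! ### From bit strings to matrices -/

section Matrices

variable {Q : Type} [Fintype Q] [DecidableEq Q]

/-- The matrix that sends the basis vector `|x⟩` to `|f x⟩`. -/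
def mapMatrix (f : (Q → Bool) → (Q → Bool)) : Matrix (Q → Bool) (Q → Bool) ℂ :=
  Matrix.of fun y x => if y = f x then 1 else 0

theorem mapMatrix_mul (f g : (Q → Bool) → (Q → Bool)) :
    mapMatrix f * mapMatrix g = mapMatrix fun x => f (g x) := by
  ext y x
  simp [mapMatrix, Matrix.mul_apply]

theorem mapMatrix_id : mapMatrix (fun x : Q → Bool => x) = 1 := by
  ext y x
  simp [mapMatrix, Matrix.one_apply]

theorem MCX.matrix_eq (g : MCX Q) : g.matrix = mapMatrix (mcx g.controls g.target) := by
  rw [← MCX.act_eq_mcx]; rfl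

theorem mulVec_ket (M : Matrix (Q → Bool) (Q → Bool) ℂ) (x : Q → Bool) :
    M.mulVec (ket x) = fun y => M y x := by
  ext y
  simp [ket]

theorem mapMatrix_mulVec_ket (f : (Q → Bool) → (Q → Bool)) (x : Q → Bool) :
    (mapMatrix f).mulVec (ket x) = ket (f x) := by
  rw [mulVec_ket]
  ext y
  simp [mapMatrix, ket, Pi.single_apply]

theorem matrix_ext_ket {M N : Matrix (Q → Bool) (Q → Bool) ℂ}
    (h : ∀ x, M.mulVec (ket x) = N.mulVec (ket x)) : M = N := by
  ext y x
  have := congrFun (h x) y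
  simpa [mulVec_ket] using this

theorem circuitMatrix_run (C : List (MCX Q)) :
    circuitMatrix MCX.matrix C = mapMatrix (run C) := by
  induction C with
  | nil => exact mapMatrix_id.symm
  | cons g C ih =>
    simp only [circuitMatrix, ih, MCX.matrix_eq, mapMatrix_mul]
    congr 1; funext x; simp

theorem circuitMatrix_append {G : Type} (mat : G → Matrix (Q → Bool) (Q → Bool) ℂ)
    (C C' : List G) :
    circuitMatrix mat (C ++ C') = circuitMatrix mat C' * circuitMatrix mat C := by
  induction C with
  | nil => simp [circuitMatrix]
  | cons g C ih => simp [circuitMatrix, ih, Matrix.mul_assoc]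

end Matrices

/-! ### Calculus of depth: sequential and parallel composition -/

section Depth

variable {Q : Type} [Fintype Q] [DecidableEq Q]

theorem busyUntil_append (C C' : List (PrimGate Q)) (t : Q → ℕ) :
    busyUntil (C ++ C') t = busyUntil C' (busyUntil C t) := by
  induction C generalizing t with
  | nil => rfl
  | cons g C ih => simp [busyUntil, ih]

theorem busyUntil_of_notMem {C : List (PrimGate Q)} {S : Finset Q}
    (hC : ∀ g ∈ C, g.support ⊆ S) {q : Q} (hq : q ∉ S) (t : Q → ℕ) : busyUntil C t q = t q := by
  induction C generalizing t with
  | nil => rfl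
  | cons g C ih =>
    have hg : q ∉ g.support := fun h => hq (hC g (by simp) h)
    rw [busyUntil, ih fun g' h' => hC g' (by simp [h'])]
    simp [hg]

/-- There is a circuit of primitive gates on the qubits in `S` that has the matrix `M` and keeps
these qubits busy for at most `d` time steps. -/
def Implements (S : Finset Q) (d : ℕ) (M : Matrix (Q → Bool) (Q → Bool) ℂ) : Prop :=
  ∃ C : List (PrimGate Q), (∀ g ∈ C, g.support ⊆ S) ∧
    (∀ t : Q → ℕ, ∀ T : ℕ, (∀ q ∈ S, t q ≤ T) → ∀ q ∈ S, busyUntil C t q ≤ T + d) ∧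
    circuitMatrix PrimGate.matrix C = M

theorem Implements.one : Implements (∅ : Finset Q) 0 1 :=
  ⟨[], by simp, by simp, rfl⟩

theorem Implements.mono {S S' : Finset Q} {d d' : ℕ} {M : Matrix (Q → Bool) (Q → Bool) ℂ}
    (h : Implements S d M) (hS : S ⊆ S') (hd : d ≤ d') : Implements S' d' M := by
  obtain ⟨C, hC, ht, hM⟩ := h
  refine ⟨C, fun g hg => (hC g hg).trans hS, fun t T h q hq => ?_, hM⟩
  by_cases hqS : q ∈ S
  · exact (ht t T (fun p hp => h p (hS hp)) q hqS).trans (by omega)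
  · rw [busyUntil_of_notMem hC hqS]
    exact (h q hq).trans (by omega)

theorem Implements.seq {S : Finset Q} {d d' : ℕ} {M N : Matrix (Q → Bool) (Q → Bool) ℂ}
    (h : Implements S d M) (h' : Implements S d' N) : Implements S (d + d') (N * M) := by
  obtain ⟨C, hC, ht, hM⟩ := h
  obtain ⟨C', hC', ht', hN⟩ := h'
  refine ⟨C ++ C', ?_, fun t T hT q hq => ?_, by rw [circuitMatrix_append, hM, hN]⟩
  · intro g hg
    rcases List.mem_append.1 hg with hg | hg
    exacts [hC g hg, hC' g hg]
  · rw [busyUntil_append, ← add_assoc]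
    exact ht' _ _ (ht t T hT) q hq

/-- Depth does not add here: scheduling is greedy, and the first circuit leaves the free times of
the qubits in `S'` untouched. Quantifying over all start times `t` in `Implements` is what makes
both compositions work. -/
theorem Implements.par {S S' : Finset Q} {d : ℕ} {M N : Matrix (Q → Bool) (Q → Bool) ℂ}
    (h : Implements S d M) (h' : Implements S' d N) (hSS' : Disjoint S S') :
    Implements (S ∪ S') d (N * M) := by
  obtain ⟨C, hC, ht, hM⟩ := h
  obtain ⟨C', hC', ht', hN⟩ := h'
  refine ⟨C ++ C', ?_, fun t T hT q hq => ?_, by rw [circuitMatrix_append, hM, hN]⟩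
  · intro g hg
    rcases List.mem_append.1 hg with hg | hg
    exacts [(hC g hg).trans Finset.subset_union_left, (hC' g hg).trans Finset.subset_union_right]
  · rw [busyUntil_append]
    have hS' : ∀ p ∈ S', busyUntil C t p ≤ T := fun p hp => by
      rw [busyUntil_of_notMem hC (Finset.disjoint_right.1 hSS' hp)]
      exact hT p (Finset.mem_union_right _ hp)
    rcases Finset.mem_union.1 hq with hq | hq
    · rw [busyUntil_of_notMem hC' (Finset.disjoint_left.1 hSS' hq)]
      exact ht t T (fun p hp => hT p (Finset.mem_union_left _ hp)) q hq
    · exact ht' _ _ hS' q hq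

theorem Implements.gate (g : PrimGate Q) : Implements g.support 1 g.matrix := by
  refine ⟨[g], by simp, fun t T hT q hq => ?_, by simp [circuitMatrix]⟩
  simp only [busyUntil, hq, if_true]
  exact Nat.add_le_add_right (Finset.sup_le hT) 1

theorem Implements.circuit {S : Finset Q} (C : List (PrimGate Q)) (hC : ∀ g ∈ C, g.support ⊆ S) :
    Implements S C.length (circuitMatrix PrimGate.matrix C) := by
  induction C with
  | nil => exact Implements.one.mono (by simp) le_rfl
  | cons g C ih =>
    have h := (Implements.gate g).mono (hC g (by simp)) le_rfl
    have h' := h.seq (ih fun g' h' => hC g' (by simp [h']))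
    rw [add_comm] at h'
    exact h'

theorem exists_decomposition {V : List (MCX Q)} {d : ℕ}
    (h : ∀ g ∈ V, Implements Finset.univ d g.matrix) :
    ∃ W, IsDecomposition W V ∧ depth W ≤ V.length * d := by
  have key : ∃ blocks : List (List (PrimGate Q)),
      List.Forall₂ (fun g b => circuitMatrix PrimGate.matrix b = MCX.matrix g) V blocks ∧
      ∀ (t : Q → ℕ) (T : ℕ), (∀ q, t q ≤ T) →
        ∀ q, busyUntil blocks.flatten t q ≤ T + V.length * d := by
    induction V with
    | nil => exact ⟨[], List.Forall₂.nil, fun t T hT q => by simpa [busyUntil] using hT q⟩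
    | cons g V ih =>
      obtain ⟨C, -, ht, hM⟩ := h g (by simp)
      obtain ⟨bs, hbs, hT⟩ := ih fun g' h' => h g' (by simp [h'])
      refine ⟨C :: bs, List.Forall₂.cons hM hbs, fun t T h0 q => ?_⟩
      rw [List.flatten_cons, busyUntil_append]
      refine (hT _ (T + d) (fun p => ht t T (fun p _ => h0 p) p (by simp)) q).trans ?_
      rw [List.length_cons, Nat.succ_mul]
      omega
  obtain ⟨bs, hbs, hT⟩ := key
  refine ⟨bs.flatten, ⟨bs, hbs, rfl⟩, Finset.sup_le fun q _ => ?_⟩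
  simpa using hT (fun _ => 0) 0 (by simp) q

end Depth

/-! ### Exact circuits for gates with at most two controls -/

section Toffoli

variable {Q : Type} [Fintype Q] [DecidableEq Q]

/-- The unitary `diag(1, z)` for a complex number `z` of modulus one. -/
noncomputable def phaseUnitary (z : Circle) : Matrix.unitaryGroup Bool ℂ :=
  ⟨Matrix.diagonal fun b => if b then (z : ℂ) else 1, by
    rw [Matrix.mem_unitaryGroup_iff, Matrix.star_eq_conjTranspose, Matrix.diagonal_conjTranspose,
      Matrix.diagonal_mul_diagonal, ← Matrix.diagonal_one]
    congr 1
    funext b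
    cases b <;> simp [Complex.mul_conj, Circle.normSq_coe]⟩

theorem sqrt_two_inv_mul_self : ((Real.sqrt 2 : ℂ))⁻¹ * ((Real.sqrt 2 : ℂ))⁻¹ = 1 / 2 := by
  rw [← mul_inv, ← Complex.ofReal_mul, Real.mul_self_sqrt (by norm_num)]
  norm_num

/-- The Hadamard gate. -/
noncomputable def hadamard : Matrix.unitaryGroup Bool ℂ :=
  ⟨Matrix.of fun b c => ((Real.sqrt 2 : ℂ))⁻¹ * if b && c then -1 else 1, by
    rw [Matrix.mem_unitaryGroup_iff]
    ext b c
    cases b <;> cases c <;>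
      (simp [Matrix.mul_apply, Matrix.star_apply, sqrt_two_inv_mul_self]; try norm_num)⟩

theorem phaseUnitary_matrix_mulVec_ket (q : Q) (z : Circle) (x : Q → Bool) :
    (PrimGate.single q (phaseUnitary z)).matrix.mulVec (ket x) =
      (if x q then (z : ℂ) else 1) • ket x := by
  rw [mulVec_ket]
  ext y
  by_cases h : y = x
  · subst h; simp [PrimGate.matrix, phaseUnitary, ket]
  · have : (∀ p, p ≠ q → y p = x p) → y q ≠ x q := fun h1 h2 => h (by
      ext p
      by_cases hp : p = q
      · rw [hp, h2]
      · rw [h1 p hp])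
    simp only [PrimGate.matrix, phaseUnitary, ket, Matrix.of_apply, Pi.smul_apply, Pi.single_apply,
      h, if_false, smul_zero]
    split_ifs with h1
    · simp [this h1]
    · rfl

theorem cnot_matrix_mulVec_ket (c t : Q) (h : t ≠ c) (x : Q → Bool) :
    (PrimGate.cnot c t h).matrix.mulVec (ket x) = ket (toggle t (x c) x) := by
  simp only [PrimGate.matrix, MCX.matrix_eq, mapMatrix_mulVec_ket, cxGate, mcx, allOn]
  simp

theorem hadamard_conj_apply (q : Q) (φ : (Q → Bool) → ℂ) (x y : Q → Bool) :
    ((PrimGate.single q hadamard).matrix * (Matrix.diagonal φ *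
      (PrimGate.single q hadamard).matrix)) y x =
    if ∀ p, p ≠ q → y p = x p then
      (1 / 2) * (φ (Function.update x q false) +
        (if y q ^^ x q then -1 else 1) * φ (Function.update x q true)) else 0 := by
  -- Only the two intermediate strings that agree with `x` away from `q` contribute to the matrix
  -- product.
  have key : ∀ z, (PrimGate.single q hadamard).matrix y z *
      (Matrix.diagonal φ * (PrimGate.single q hadamard).matrix) z x =
      if z = Function.update x q false ∨ z = Function.update x q true then
        if ∀ p, p ≠ q → y p = x p then
          (hadamard : Matrix Bool Bool ℂ) (y q) (z q) * (φ z *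
            (hadamard : Matrix Bool Bool ℂ) (z q) (x q)) else 0 else 0 := by
    intro z
    rw [Matrix.diagonal_mul]
    simp only [PrimGate.matrix, Matrix.of_apply]
    by_cases hz : ∀ p, p ≠ q → z p = x p
    · have h1 : z = Function.update x q false ∨ z = Function.update x q true := by
        rcases hzq : z q with _ | _
        · left
          ext p
          by_cases hp : p = q
          · subst hp; simp [hzq]
          · simp [hp, hz p hp]
        · right
          ext p
          by_cases hp : p = q
          · subst hp; simp [hzq]
          · simp [hp, hz p hp]
      have h2 : (∀ p, p ≠ q → y p = z p) ↔ ∀ p, p ≠ q → y p = x p :=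
        forall₂_congr fun p hp => by rw [hz p hp]
      simp only [h1, h2, if_true, ne_eq]
      split_ifs <;> simp
    · have h1 : ¬(z = Function.update x q false ∨ z = Function.update x q true) := by
        rintro (rfl | rfl) <;> exact hz fun p hp => by simp [hp]
      simp [h1, hz]
  rw [Matrix.mul_apply, Finset.sum_congr rfl fun z _ => key z, ← Finset.sum_filter]
  have hne : Function.update x q false ≠ Function.update x q true := fun h => by
    simpa using congrFun h q
  have : (Finset.univ.filter fun z => z = Function.update x q false ∨
      z = Function.update x q true) = {Function.update x q false, Function.update x q true} := by
    ext z; simp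
  rw [this, Finset.sum_pair hne]
  split_ifs with h h'
  · have h2 := sqrt_two_inv_mul_self
    simp only [hadamard, Matrix.of_apply, Function.update_self]
    rcases hy : y q with _ | _ <;> rcases hx : x q with _ | _ <;> simp_all <;>
      linear_combination
        (φ (Function.update x q false) - φ (Function.update x q true)) * h2
  · have h2 := sqrt_two_inv_mul_self
    simp only [hadamard, Matrix.of_apply, Function.update_self]
    rcases hy : y q with _ | _ <;> rcases hx : x q with _ | _ <;> simp_all <;>
      linear_combination
        (φ (Function.update x q false) + φ (Function.update x q true)) * h2
  · simp

/-- A circuit of CNOT and `T` gates for the doubly controlled `Z` gate. -/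
noncomputable def cczCircuit (a b t : Q) (hab : b ≠ a) (hat : t ≠ a) (hbt : t ≠ b) :
    List (PrimGate Q) :=
  let ω := Circle.exp (Real.pi / 4)
  [.single a (phaseUnitary ω), .single b (phaseUnitary ω), .single t (phaseUnitary ω),
    .cnot a b hab, .single b (phaseUnitary ω⁻¹), .cnot b t hbt, .single t (phaseUnitary ω),
    .cnot a b hab, .cnot b t hbt, .single t (phaseUnitary ω⁻¹), .cnot a t hat, .cnot b t hbt,
    .single t (phaseUnitary ω⁻¹), .cnot b t hbt]

theorem circle_exp_pi_div_four_pow : ((Circle.exp (Real.pi / 4) : Circle) : ℂ) ^ 4 = -1 := by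
  rw [Circle.coe_exp, ← Complex.exp_nat_mul, ← Complex.exp_pi_mul_I]
  congr 1
  push_cast
  ring

/-- The phases collected are powers of ω = exp(iπ/4), and for bits 4abt = a + b + t - (a⊕b) - (b⊕t)
- (a⊕t) + (a⊕b⊕t), so the total phase is ω ^ (4abt) = (-1) ^ (abt). The CNOT gates produce the
parities and then undo them. -/
theorem cczCircuit_matrix (a b t : Q) (hab : b ≠ a) (hat : t ≠ a) (hbt : t ≠ b) :
    circuitMatrix PrimGate.matrix (cczCircuit a b t hab hat hbt) =
      Matrix.diagonal fun x => if x a && x b && x t then -1 else 1 := by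
  refine matrix_ext_ket fun x => ?_
  have hω := circle_exp_pi_div_four_pow
  have hω0 : ((Circle.exp (Real.pi / 4) : Circle) : ℂ) ≠ 0 := Circle.coe_ne_zero _
  have hrhs : (Matrix.diagonal fun x : Q → Bool => if x a && x b && x t then (-1 : ℂ) else 1).mulVec
      (ket x) = (if x a && x b && x t then (-1 : ℂ) else 1) • ket x := by
    rw [mulVec_ket]
    ext y
    by_cases h : y = x
    · subst h; simp [ket]
    · simp [ket, h]
  rw [hrhs]
  simp only [cczCircuit, circuitMatrix, one_mul, ← Matrix.mulVec_mulVec,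
    phaseUnitary_matrix_mulVec_ket, cnot_matrix_mulVec_ket, Matrix.mulVec_smul, smul_smul,
    toggle_same, toggle_of_ne hbt, toggle_of_ne hab.symm,
    toggle_of_ne hat.symm, toggle_of_ne hbt.symm]
  generalize ((Circle.exp (Real.pi / 4) : Circle)) = w at hω hω0 ⊢
  rcases ha : x a with _ | _ <;> rcases hb : x b with _ | _ <;> rcases ht : x t with _ | _ <;>
    simp [toggle_toggle, toggle_comm t b]
  -- What remains is the case of three ones, with phase ω⁴ = -1.
  rw [← neg_one_smul ℂ (ket x), ← hω]
  congr 1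
  ring

/-- Conjugation by a Hadamard gate on the target turns a controlled Z into a controlled X, as HZH =
X. -/
theorem implements_mcx_of_diagonal {S T : Finset Q} {t : Q} {d : ℕ} (ht : t ∉ S) (htT : t ∈ T)
    (h : Implements T d (Matrix.diagonal fun x => if allOn S x && x t then -1 else 1)) :
    Implements T (1 + d + 1) (mapMatrix (mcx S t)) := by
  have hH := (Implements.gate (.single t hadamard)).mono (S' := T) (by simpa [PrimGate.support])
    le_rfl
  convert (hH.seq h).seq hH using 1
  ext y x
  rw [hadamard_conj_apply]
  have h1 : ∀ b, allOn S (Function.update x t b) = allOn S x := fun b =>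
    allOn_congr fun c hc => Function.update_of_ne (ne_of_mem_of_not_mem hc ht) _ _
  simp only [h1, Function.update_self, mapMatrix, Matrix.of_apply, mcx]
  have h2 : y = toggle t (allOn S x) x ↔
      (∀ p, p ≠ t → y p = x p) ∧ y t = (x t ^^ allOn S x) := by
    constructor
    · rintro rfl
      exact ⟨fun p hp => toggle_of_ne hp _ _, toggle_same _ _ _⟩
    · rintro ⟨h3, h4⟩
      ext p
      by_cases hp : p = t
      · subst hp; rw [h4, toggle_same]
      · rw [h3 p hp, toggle_of_ne hp]
  by_cases h3 : ∀ p, p ≠ t → y p = x p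
  · simp only [h2, eq_true h3, true_and, if_true]
    rcases y t with _ | _ <;> rcases x t with _ | _ <;> rcases allOn S x with _ | _ <;>
      norm_num
  · simp only [h2, eq_false h3, false_and, if_false]

theorem implements_not (t : Q) : Implements {t} 3 (mapMatrix (mcx ∅ t)) := by
  refine implements_mcx_of_diagonal (d := 1) (by simp) (by simp) ?_
  suffices h : Matrix.diagonal (fun x : Q → Bool => if allOn ∅ x && x t then (-1 : ℂ) else 1) =
      (PrimGate.single t (phaseUnitary (Circle.exp Real.pi))).matrix by
    rw [h]
    exact Implements.gate (PrimGate.single t _)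
  refine matrix_ext_ket fun x => ?_
  rw [phaseUnitary_matrix_mulVec_ket, Circle.coe_exp, Complex.exp_pi_mul_I, mulVec_ket]
  ext y
  by_cases h : y = x
  · subst h; simp [ket, allOn]
  · simp [ket, h]

theorem implements_mcx_of_card_le_two {S : Finset Q} {t : Q} (ht : t ∉ S) (hS : S.card ≤ 2) :
    Implements (insert t S) 16 (mapMatrix (mcx S t)) := by
  have h3 : S.card = 0 ∨ S.card = 1 ∨ S.card = 2 := by omega
  rcases h3 with h | h | h
  · rw [Finset.card_eq_zero.1 h]
    exact (implements_not t).mono (by simp) (by norm_num)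
  · obtain ⟨c, rfl⟩ := Finset.card_eq_one.1 h
    have hc : t ≠ c := by simpa using ht
    refine Implements.mono (S := {c, t}) (d := 1) ?_ (by simp [Finset.subset_iff]) (by norm_num)
    suffices h : mapMatrix (mcx {c} t) = (PrimGate.cnot c t hc).matrix by
      rw [h]
      exact Implements.gate (PrimGate.cnot c t hc)
    refine matrix_ext_ket fun x => ?_
    rw [cnot_matrix_mulVec_ket, mapMatrix_mulVec_ket]
    simp [mcx, allOn]
  · obtain ⟨a, b, hab, rfl⟩ := Finset.card_eq_two.1 h
    have hta : t ≠ a ∧ t ≠ b := by simpa using ht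
    refine implements_mcx_of_diagonal (d := 14) ht (by simp) ?_
    have : Implements {t, a, b} 14 _ := Implements.circuit (cczCircuit a b t hab.symm hta.1 hta.2)
      (by simp [cczCircuit, PrimGate.support, Finset.subset_iff])
    rw [cczCircuit_matrix] at this
    simpa [allOn] using this

end Toffoli

/-! ### Distributing a finite set into disjoint groups -/

section Groups

variable {Q : Type} [DecidableEq Q]

theorem exists_disjoint_cover (C T : Finset Q) (b : ℕ) (h : T.card ≤ C.card * b) :
    ∃ grp : Q → Finset Q, (∀ p ∈ C, (grp p).card ≤ b) ∧
      (∀ p ∈ C, ∀ p' ∈ C, p ≠ p' → Disjoint (grp p) (grp p')) ∧ C.biUnion grp = T := by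
  induction C using Finset.induction_on generalizing T with
  | empty =>
    refine ⟨fun _ => ∅, by simp, by simp, ?_⟩
    have : T.card = 0 := by simpa using h
    rw [Finset.card_eq_zero.1 this]; rfl
  | insert p C hp ih =>
    rw [Finset.card_insert_of_notMem hp, Nat.succ_mul] at h
    obtain ⟨R, hRT, hR⟩ := Finset.exists_subset_card_eq (min_le_right b T.card)
    obtain ⟨grp, h1, h2, h3⟩ := ih (T \ R) (by
      rw [Finset.card_sdiff_of_subset hRT, hR]; omega)
    have hne : ∀ p' ∈ C, p' ≠ p := fun p' h' => ne_of_mem_of_not_mem h' hp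
    have hd : ∀ p' ∈ C, Disjoint R (grp p') := fun p' h' =>
      (Finset.disjoint_sdiff).mono_right (h3 ▸ Finset.subset_biUnion_of_mem grp h')
    refine ⟨Function.update grp p R, ?_, ?_, ?_⟩
    · intro p' h'
      rcases Finset.mem_insert.1 h' with rfl | h'
      · rw [Function.update_self, hR]; exact min_le_left _ _
      · rw [Function.update_of_ne (hne p' h')]; exact h1 p' h'
    · intro p₁ hp₁ p₂ hp₂ h12
      rcases Finset.mem_insert.1 hp₁ with h₁ | h₁ <;> rcases Finset.mem_insert.1 hp₂ with h₂ | h₂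
      · exact absurd (h₁.trans h₂.symm) h12
      · rw [h₁, Function.update_self, Function.update_of_ne (hne _ h₂)]; exact hd _ h₂
      · rw [h₂, Function.update_self, Function.update_of_ne (hne _ h₁)]; exact (hd _ h₁).symm
      · rw [Function.update_of_ne (hne _ h₁), Function.update_of_ne (hne _ h₂)]
        exact h2 _ h₁ _ h₂ h12
    · rw [Finset.biUnion_insert, Function.update_self, Finset.biUnion_congr rfl
        fun p' h' => Function.update_of_ne (hne p' h') _ _, h3, Finset.union_sdiff_of_subset hRT]

theorem exists_disjoint_card_eq (C T : Finset Q) (b : ℕ) (h : C.card * b ≤ T.card) :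
    ∃ grp : Q → Finset Q, (∀ p ∈ C, (grp p).card = b) ∧
      (∀ p ∈ C, ∀ p' ∈ C, p ≠ p' → Disjoint (grp p) (grp p')) ∧ C.biUnion grp ⊆ T := by
  obtain ⟨R, hRT, hR⟩ := Finset.exists_subset_card_eq h
  obtain ⟨grp, h1, h2, h3⟩ := exists_disjoint_cover C R b hR.le
  refine ⟨grp, ?_, h2, h3 ▸ hRT⟩
  -- The groups exhaust a set of exactly `C.card * b` elements, so none of them can be smaller than
  -- `b`.
  have h4 : ∑ p ∈ C, (grp p).card = ∑ p ∈ C, b := by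
    rw [← Finset.card_biUnion h2, h3, hR, Finset.sum_const, smul_eq_mul]
  exact (Finset.sum_eq_sum_iff_of_le h1).1 h4

end Groups

/-! ### The square-root recursion with borrowed qubits -/

section Recursion

variable {Q : Type} [Fintype Q] [DecidableEq Q]

/-- At every qubit `p` in `C`, add the negated conjunction of the bits in `grp p`. -/
def nandAll (C : Finset Q) (grp : Q → Finset Q) (x : Q → Bool) : Q → Bool :=
  fun p => x p ^^ (decide (p ∈ C) && !allOn (grp p) x)

theorem nandAll_of_notMem {C : Finset Q} (grp : Q → Finset Q) {p : Q} (hp : p ∉ C) (x : Q → Bool) :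
    nandAll C grp x p = x p := by
  simp [nandAll, hp]

theorem nandAll_toggle {C : Finset Q} {grp : Q → Finset Q} {t : Q}
    (h : ∀ p ∈ C, t ∉ grp p) (b : Bool) (x : Q → Bool) :
    nandAll C grp (toggle t b x) = toggle t b (nandAll C grp x) := by
  ext p
  simp only [nandAll, toggle_apply]
  by_cases hp : p ∈ C
  · rw [allOn_toggle (h p hp), Bool.xor_assoc, Bool.xor_assoc, Bool.xor_comm (decide (p = t) && b)]
  · simp [hp]

theorem nandAll_nandAll {C : Finset Q} {grp : Q → Finset Q}
    (h : ∀ p ∈ C, Disjoint (grp p) C) (x : Q → Bool) :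
    nandAll C grp (nandAll C grp x) = x := by
  ext p
  by_cases hp : p ∈ C
  · have : allOn (grp p) (nandAll C grp x) = allOn (grp p) x := allOn_congr fun c hc =>
      nandAll_of_notMem grp (Finset.disjoint_left.1 (h p hp) hc) x
    rw [nandAll, this]
    simp [nandAll]
  · simp [nandAll, hp]

/-- If every group can be handled in depth `d` on its own set of qubits, then all groups can be
handled in parallel. -/
theorem implements_nandAll {C : Finset Q} {grp reg : Q → Finset Q} {d : ℕ}
    (himp : ∀ p ∈ C, Implements (reg p) d (mapMatrix (mcx (grp p) p)))
    (hmem : ∀ p ∈ C, p ∈ reg p)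
    (hgrp : ∀ p ∈ C, Disjoint (grp p) C)
    (hdisj : ∀ p ∈ C, ∀ p' ∈ C, p ≠ p' → Disjoint (reg p) (reg p')) :
    Implements (C.biUnion reg) (3 + d) (mapMatrix (nandAll C grp)) := by
  induction C using Finset.induction_on with
  | empty =>
    have : mapMatrix (nandAll (∅ : Finset Q) grp) = 1 := by
      rw [← mapMatrix_id]; congr 1; funext x; ext p; simp [nandAll]
    rw [this]
    exact Implements.one.mono (by simp) (by omega)
  | insert p C hp ih =>
    have h1 := ih (fun p' h' => himp p' (by simp [h'])) (fun p' h' => hmem p' (by simp [h']))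
      (fun p' h' => (hgrp p' (by simp [h'])).mono_right (by simp))
      (fun p₁ h₁ p₂ h₂ => hdisj p₁ (by simp [h₁]) p₂ (by simp [h₂]))
    -- A NOT gate on `p`, of depth 3, turns the added conjunction into its negation.
    have h2 := ((implements_not p).mono (Finset.singleton_subset_iff.2 (hmem p (by simp)))
      le_rfl).seq (himp p (by simp))
    have hd : Disjoint (C.biUnion reg) (reg p) := by
      rw [Finset.disjoint_biUnion_left]
      exact fun p' h' => hdisj p' (by simp [h']) p (by simp) (ne_of_mem_of_not_mem h' hp)
    convert h1.par h2 hd using 1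
    · rw [Finset.biUnion_insert, Finset.union_comm]
    · rw [mapMatrix_mul, mapMatrix_mul]
      congr 1
      funext x
      have hpp : p ∉ grp p := Finset.disjoint_right.1 (hgrp p (by simp)) (by simp)
      have h3 : allOn (grp p) (nandAll C grp x) = allOn (grp p) x := allOn_congr fun c hc =>
        nandAll_of_notMem grp (fun hcC => Finset.disjoint_left.1 (hgrp p (by simp)) hc
          (by simp [hcC])) x
      ext p'
      simp only [mcx, allOn_toggle hpp, h3, toggle_apply]
      by_cases hpp' : p' = p
      · subst hpp'
        simp [nandAll, hp, allOn, Bool.xor_comm]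
      · simp [nandAll, hpp']

/-- A multi-controlled NOT gate from gates with fewer controls and a borrowed qubit `a`. -/
theorem mcx_eq_borrow {S₀ C : Finset Q} {grp : Q → Finset Q} {a t : Q} (hC : C ⊆ S₀)
    (hgrp : ∀ p ∈ C, Disjoint (grp p) S₀) (ha : a ∉ S₀ ∪ C.biUnion grp)
    (ht : t ∉ S₀ ∪ C.biUnion grp) (hta : t ≠ a) (x : Q → Bool) :
    let U := fun x => nandAll C grp (mcx (insert a C) t (nandAll C grp x))
    mcx S₀ a (U (mcx S₀ a (U x))) = mcx (S₀ ∪ C.biUnion grp) t x := by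
  intro U
  simp only [Finset.mem_union, Finset.mem_biUnion, not_or, not_exists, not_and] at ha ht
  -- `nandAll` is an involution that commutes with flips of `t`, so conjugating by it only changes
  -- the condition under which `t` is flipped.
  have hU : ∀ x, U x = toggle t (x a && allOn C (nandAll C grp x)) x := by
    intro x
    simp only [U, mcx, allOn_insert]
    rw [nandAll_toggle ht.2, nandAll_nandAll fun p hp => (hgrp p hp).mono_right hC,
      nandAll_of_notMem grp fun h => ha.1 (hC h)]
  have hW : ∀ s b x, s ∉ S₀ → (∀ p ∈ C, s ∉ grp p) →
      allOn C (nandAll C grp (toggle s b x)) = allOn C (nandAll C grp x) := by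
    intro s b x hs hs'
    rw [nandAll_toggle hs', allOn_toggle fun h => hs (hC h)]
  -- If all bits in `S₀` are 1, then `nandAll` leaves at `p ∈ C` the bit 1 ⊕ NAND = AND of the group
  -- of `p`; otherwise both sides are false.
  have hfin : (allOn S₀ x && allOn C (nandAll C grp x)) = allOn (S₀ ∪ C.biUnion grp) x := by
    rw [Bool.eq_iff_iff]
    simp only [allOn, Bool.and_eq_true, decide_eq_true_eq, Finset.mem_union, Finset.mem_biUnion]
    constructor
    · rintro ⟨h1, h2⟩ c (hc | ⟨p, hp, hc⟩)
      · exact h1 c hc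
      · have := h2 p hp
        simp only [nandAll, hp, h1 p (hC hp), allOn, decide_true, Bool.true_and, Bool.true_xor,
          Bool.not_not, decide_eq_true_eq] at this
        exact this c hc
    · intro h
      refine ⟨fun c hc => h c (.inl hc), fun p hp => ?_⟩
      simp only [nandAll, hp, h p (.inl (hC hp)), allOn, decide_true, Bool.true_and, Bool.true_xor,
          Bool.not_not, decide_eq_true_eq]
      exact fun c hc => h c (.inr ⟨p, hp, hc⟩)
  have hL : ∀ s b x, s ∉ S₀ → allOn S₀ (toggle s b x) = allOn S₀ x := fun s b x hs =>
    allOn_toggle hs b x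
  simp only [hU, mcx, hW t _ _ ht.1 ht.2, hW a _ _ ha.1 ha.2, hL t _ _ ht.1, hL a _ _ ha.1,
    toggle_same, toggle_of_ne hta.symm]
  rw [toggle_comm t a, toggle_toggle, toggle_toggle, Bool.xor_self, toggle_false, ← hfin]
  congr 1
  -- The unknown bit of `a` cancels: (a∧w) ⊕ ((a⊕s)∧w) = s∧w.
  cases x a <;> cases allOn S₀ x <;> cases allOn C (nandAll C grp x) <;> rfl

/-- A NOT gate with at most `2 ^ 2 ^ j` controls has depth `O(8 ^ j)` if `2 ^ 2 ^ j` qubits can be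
borrowed. -/
theorem implements_mcx (j : ℕ) (S B : Finset Q) (t : Q) (htS : t ∉ S) (htB : t ∉ B)
    (hSB : Disjoint S B) (hS : S.card ≤ 2 ^ 2 ^ j) (hB : 2 ^ 2 ^ j ≤ B.card) :
    Implements (insert t (S ∪ B)) (18 * 8 ^ j - 2) (mapMatrix (mcx S t)) := by
  induction j generalizing S B t with
  | zero =>
    refine (implements_mcx_of_card_le_two htS (by simpa using hS)).mono ?_ (by norm_num)
    exact Finset.insert_subset_insert _ Finset.subset_union_left
  | succ j ih =>
    rw [pow_succ 2 j, pow_mul] at hS hB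
    obtain ⟨b, hb⟩ : ∃ b, 2 ^ 2 ^ j = b := ⟨_, rfl⟩
    have hb2 : 2 ≤ b := hb ▸ (Nat.le_self_pow (by positivity) 2)
    rw [hb, sq] at hS hB
    simp only [hb] at ih
    -- At most b² - b controls lie outside `S₀`, so b - 1 groups of size b hold them. Taking only b
    -- - 1 carriers in `C` leaves room for `a` as a further control. Of the b² borrowed qubits, one
    -- is `a`, and (b - 1)b suffice to give each group b of its own.
    obtain ⟨S₀, hS₀S, hS₀⟩ := Finset.exists_subset_card_eq (min_le_right b S.card)
    obtain ⟨C, hCS₀, hC⟩ := Finset.exists_subset_card_eq (min_le_right (b - 1) S₀.card)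
    obtain ⟨c, rfl⟩ : ∃ c, b = c + 1 := ⟨b - 1, by omega⟩
    have hCc : C.card ≤ c := hC ▸ min_le_left _ _
    have hR : (S \ S₀).card ≤ C.card * (c + 1) := by
      rw [Finset.card_sdiff_of_subset hS₀S]
      rcases le_total (c + 1) S.card with h | h
      · rw [min_eq_left h] at hS₀
        rw [hS₀, Nat.add_sub_cancel, min_eq_left (Nat.le_succ c)] at hC
        rw [hS₀, hC]
        exact Nat.sub_le_iff_le_add.2 (by linarith)
      · rw [hS₀, min_eq_right h, Nat.sub_self]
        exact Nat.zero_le _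
    obtain ⟨a, ha⟩ : B.Nonempty := Finset.card_pos.1 (by nlinarith)
    have hB' : (B.erase a).card + 1 = B.card := Finset.card_erase_add_one ha
    have hBc : c * (c + 1) + c ≤ (B.erase a).card := by linarith
    obtain ⟨grp, hgc, hgd, hgS⟩ := exists_disjoint_cover C (S \ S₀) (c + 1) hR
    obtain ⟨dir, hdc, hdd, hdB⟩ := exists_disjoint_card_eq C (B.erase a) (c + 1)
      ((Nat.mul_le_mul_right _ hCc).trans (by linarith))
    have hgsub : ∀ p ∈ C, grp p ⊆ S \ S₀ := fun p hp =>
      hgS ▸ Finset.subset_biUnion_of_mem grp hp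
    have hdsub : ∀ p ∈ C, dir p ⊆ B.erase a := fun p hp =>
      (Finset.subset_biUnion_of_mem dir hp).trans hdB
    have hCS : C ⊆ S := hCS₀.trans hS₀S
    have haS : a ∉ S := Finset.disjoint_right.1 hSB ha
    have hta : t ≠ a := fun h => htB (h ▸ ha)
    have hB'S : Disjoint S (B.erase a) := hSB.mono_right (Finset.erase_subset _ _)
    have hgS₀ : ∀ p ∈ C, Disjoint (grp p) S₀ := fun p hp =>
      Finset.disjoint_of_subset_left (hgsub p hp) Finset.sdiff_disjoint
    have hSu : S₀ ∪ C.biUnion grp = S := by rw [hgS, Finset.union_sdiff_of_subset hS₀S]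
    set F := insert t (S ∪ B) with hF
    have hSF : S ⊆ F := Finset.subset_union_left.trans (Finset.subset_insert _ _)
    have hBF : B ⊆ F := Finset.subset_union_right.trans (Finset.subset_insert _ _)
    have hB'F : B.erase a ⊆ F := (Finset.erase_subset _ _).trans hBF
    have hgrpS : ∀ p ∈ C, grp p ⊆ S := fun p hp => (hgsub p hp).trans Finset.sdiff_subset
    have hW : Implements F (3 + (18 * 8 ^ j - 2)) (mapMatrix (nandAll C grp)) := by
      refine (implements_nandAll (reg := fun p => insert p (grp p ∪ dir p)) (fun p hp => ?_)
        (fun p _ => Finset.mem_insert_self _ _) (fun p hp => (hgS₀ p hp).mono_right hCS₀)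
        fun p hp p' hp' hne => ?_).mono ?_ le_rfl
      · refine ih (grp p) (dir p) p (Finset.disjoint_right.1 (hgS₀ p hp) (hCS₀ hp))
          (fun h => Finset.disjoint_left.1 hB'S (hCS hp) (hdsub p hp h))
          ((hB'S.mono_left (hgrpS p hp)).mono_right (hdsub p hp)) (hgc p hp) (hdc p hp).ge
      · have h1 : ∀ p ∈ C, ∀ p' ∈ C, p ∉ grp p' := fun p hp p' hp' =>
          Finset.disjoint_right.1 (hgS₀ p' hp') (hCS₀ hp)
        have h2 : ∀ p ∈ C, ∀ p' ∈ C, p ∉ dir p' := fun p hp p' hp' h =>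
          Finset.disjoint_left.1 hB'S (hCS hp) (hdsub p' hp' h)
        have h3 : ∀ p ∈ C, ∀ p' ∈ C, Disjoint (grp p) (dir p') := fun p hp p' hp' =>
          (hB'S.mono_left (hgrpS p hp)).mono_right (hdsub p' hp')
        rw [Finset.disjoint_insert_left, Finset.disjoint_insert_right, Finset.mem_insert,
          Finset.mem_union, Finset.mem_union, Finset.disjoint_union_left,
          Finset.disjoint_union_right, Finset.disjoint_union_right]
        exact ⟨by simp [hne, h1 p hp p' hp', h2 p hp p' hp'],
          by simp [h1 p' hp' p hp, h2 p' hp' p hp],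
          ⟨hgd p hp p' hp' hne, h3 p hp p' hp'⟩, (h3 p' hp' p hp).symm, hdd p hp p' hp' hne⟩
      · refine Finset.biUnion_subset.2 fun p hp => Finset.insert_subset (hSF (hCS hp)) ?_
        exact Finset.union_subset ((hgrpS p hp).trans hSF) ((hdsub p hp).trans hB'F)
    have hM : Implements F (18 * 8 ^ j - 2) (mapMatrix (mcx (insert a C) t)) := by
      refine (ih (insert a C) (B.erase a) t ?_ (fun h => htB (Finset.mem_of_mem_erase h)) ?_ ?_
        ?_).mono ?_ le_rfl
      · simpa [hta] using fun h => htS (hCS h)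
      · rw [Finset.disjoint_insert_left]
        exact ⟨Finset.notMem_erase _ _, hB'S.mono_left hCS⟩
      · exact (Finset.card_insert_le _ _).trans (by omega)
      · nlinarith
      · refine Finset.insert_subset (Finset.mem_insert_self _ _) (Finset.union_subset ?_ hB'F)
        exact Finset.insert_subset (hBF ha) (hCS.trans hSF)
    have hA : Implements F (18 * 8 ^ j - 2) (mapMatrix (mcx S₀ a)) := by
      refine (ih S₀ (B.erase a) a (fun h => haS (hS₀S h)) (Finset.notMem_erase _ _)
        (hB'S.mono_left hS₀S) (hS₀ ▸ min_le_left _ _) ?_).mono ?_ le_rfl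
      · nlinarith
      · exact Finset.insert_subset (hBF ha) (Finset.union_subset (hS₀S.trans hSF) hB'F)
    have hU := (hW.seq hM).seq hW
    have hall := ((hU.seq hA).seq hU).seq hA
    have heq : mapMatrix (mcx S t) = mapMatrix (mcx S₀ a) * (mapMatrix (nandAll C grp) *
        (mapMatrix (mcx (insert a C) t) * mapMatrix (nandAll C grp)) * (mapMatrix (mcx S₀ a) *
        (mapMatrix (nandAll C grp) *
        (mapMatrix (mcx (insert a C) t) * mapMatrix (nandAll C grp))))) := by
      simp only [mapMatrix_mul]
      congr 1
      funext x
      have := mcx_eq_borrow (t := t) hCS₀ hgS₀ (hSu ▸ haS) (hSu ▸ htS) hta x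
      rw [hSu] at this
      exact this.symm
    rw [heq]
    -- One level turns depth d into 2(2(3 + d) + d) + 2d = 8d + 12. The summand -2 in the bound
    -- absorbs the 12, and 18 - 2 = 16 is the base case.
    refine hall.mono subset_rfl ?_
    have : 1 ≤ 8 ^ j := Nat.one_le_pow _ _ (by norm_num)
    rw [pow_succ]
    omega

end Recursion

/-! ### Increment and binary addition -/

section Independent

variable {Q : Type} [Fintype Q] [DecidableEq Q]

/-- A qubit that is only ever a target may be flipped before or after the circuit. This is used for
the phase qubit. -/
theorem run_toggle {C : List (MCX Q)} {q : Q} (h : ∀ g ∈ C, q ∉ g.controls) (b : Bool)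
    (x : Q → Bool) : run C (toggle q b x) = toggle q b (run C x) := by
  induction C generalizing x with
  | nil => rfl
  | cons g C ih =>
    rw [run_cons, run_cons, mcx, allOn_toggle (h g (by simp)), toggle_comm,
      ih fun g' h' => h g' (by simp [h'])]
    rfl

/-- If no gate has a control or its target at the target of an earlier gate, then all gates can
be read off from the input. -/
theorem run_apply_of_pairwise {C : List (MCX Q)}
    (h : C.Pairwise fun g g' => g.target ∉ g'.controls ∧ g.target ≠ g'.target)
    (x : Q → Bool) (p : Q) :
    run C x p = (x p ^^ decide (∃ g ∈ C, g.target = p ∧ allOn g.controls x = true)) := by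
  induction C generalizing x with
  | nil => simp
  | cons g C ih =>
    rw [List.pairwise_cons] at h
    rw [run_cons, ih h.2]
    have h1 : (∃ g' ∈ C, g'.target = p ∧ allOn g'.controls (mcx g.controls g.target x) = true) ↔
        ∃ g' ∈ C, g'.target = p ∧ allOn g'.controls x = true := by
      refine exists_congr fun g' => and_congr_right fun h' => ?_
      rw [mcx, allOn_toggle (h.1 g' h').1]
    simp only [h1, List.mem_cons, exists_eq_or_imp]
    rw [mcx, toggle_apply]
    by_cases hp : p = g.target
    · have h2 : ¬∃ g' ∈ C, g'.target = p ∧ allOn g'.controls x = true := by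
        rintro ⟨g', h', h3, -⟩
        exact (h.1 g' h').2 (hp.symm.trans h3.symm)
      simp only [h2, or_false, hp.symm, true_and, decide_true, Bool.true_and, decide_false,
        Bool.xor_false, Bool.decide_eq_true]
    · simp [hp, Ne.symm hp]

theorem ctrlIncr_run_apply {m : ℕ} (a : Q) (reg : Fin m ↪ Q) (h : ∀ j, reg j ≠ a) (x : Q → Bool)
    (p : Q) : run (ctrlIncr a reg h) x p =
      (x p ^^ decide (∃ i, reg i = p ∧ x a = true ∧ ∀ j < i, x (reg j) = true)) := by
  rw [run_apply_of_pairwise]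
  · congr 2
    simp [ctrlIncr, allOn]
  · rw [ctrlIncr, List.pairwise_map, List.pairwise_reverse]
    refine (List.pairwise_lt_finRange m).imp fun {i j} hij => ⟨?_, ?_⟩
    · simpa [h] using hij.le
    · simpa using hij.ne'

end Independent

/-- The carry reaches bit `i` exactly when all lower bits are 1, which is the control condition in
INCR. -/
theorem testBit_add_one (v i : ℕ) :
    (v + 1).testBit i = (v.testBit i ^^ decide (∀ j < i, v.testBit j = true)) := by
  induction i generalizing v with
  | zero => rcases Nat.mod_two_eq_zero_or_one v with h | h <;> simp [Nat.testBit_zero, Nat.add_mod, h]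
  | succ i ih =>
    rw [Nat.testBit_succ, Nat.testBit_succ]
    have h : (∀ j < i + 1, v.testBit j = true) ↔
        v % 2 = 1 ∧ ∀ j < i, (v / 2).testBit j = true := by
      rw [Nat.forall_lt_succ_left]
      simp [Nat.testBit_succ, Nat.testBit_zero]
    simp only [h]
    rcases Nat.mod_two_eq_zero_or_one v with h0 | h0
    · rw [show (v + 1) / 2 = v / 2 by omega]
      simp [h0]
    · rw [show (v + 1) / 2 = v / 2 + 1 by omega, ih]
      simp [h0]

theorem eq_of_testBit_eq_of_lt {s v m : ℕ} (hs : s < 2 ^ m) (hv : v < 2 ^ m)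
    (h : ∀ j < m, s.testBit j = v.testBit j) : s = v := by
  refine Nat.eq_of_testBit_eq fun j => ?_
  rcases lt_or_ge j m with hj | hj
  · exact h j hj
  · have h2 := Nat.pow_le_pow_right (n := 2) (by norm_num) hj
    rw [Nat.testBit_lt_two_pow (hs.trans_le h2), Nat.testBit_lt_two_pow (hv.trans_le h2)]

/-! ### Correctness of the oracle -/

section Oracle

variable (n : ℕ)

theorem vol_apply (j : Fin (regSize n)) : vol n j = .inr (.inl (.inr j)) := rfl

theorem par_apply (j : Fin (regSize n)) : par n j = .inr (.inr (.inl j)) := rfl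

/-- The bit string of `inputBits` with `v` in the volume register. -/
def countBits (s v : ℕ) (r c : Fin n → Bool) (p : Bool) : OracleQubit n → Bool
  | .inr (.inl (.inr j)) => v.testBit j
  | x => inputBits n s r c p x

theorem countBits_zero (s : ℕ) (r c : Fin n → Bool) (p : Bool) :
    countBits n s 0 r c p = inputBits n s r c p := by
  ext x
  rcases x with (x | x) | ((x | x) | (x | x)) <;> simp [countBits, inputBits]

/-- No overflow condition is needed: both sides only see the low `regSize n` bits of the counter. -/
theorem ctrlIncr_run_countBits (s v : ℕ) (r c : Fin n → Bool) (p b : Bool) :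
    run (ctrlIncr (andQubit n) (vol n) (vol_ne_andQubit n))
      (toggle (andQubit n) b (countBits n s v r c p)) =
      toggle (andQubit n) b (countBits n s (v + b.toNat) r c p) := by
  ext x
  rw [ctrlIncr_run_apply, toggle_same]
  simp only [toggle_of_ne (vol_ne_andQubit n _)]
  by_cases hx : ∃ i, vol n i = x
  · obtain ⟨i, rfl⟩ := hx
    simp only [toggle_of_ne (vol_ne_andQubit n _), (vol n).injective.eq_iff, exists_eq_left]
    have h1 : ∀ w j, countBits n s w r c p (vol n j) = w.testBit j := fun _ _ => rfl
    have h2 : countBits n s v r c p (andQubit n) = false := rfl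
    have h3 : (∀ j < i, v.testBit j = true) ↔ ∀ j < (i : ℕ), v.testBit j = true :=
      ⟨fun h j hj => h ⟨j, hj.trans i.2⟩ hj, fun h j hj => h j hj⟩
    simp only [h1, h2, h3]
    cases b
    · simp
    · simp [testBit_add_one]
  · have h1 : ¬∃ i, vol n i = x ∧ (countBits n s v r c p (andQubit n) ^^ b) = true ∧
        ∀ j < i, countBits n s v r c p (vol n j) = true := fun ⟨i, hi, _⟩ => hx ⟨i, hi⟩
    have h2 : countBits n s v r c p x = countBits n s (v + b.toNat) r c p x := by
      rcases x with (x | x) | ((x | x) | (x | x))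
      case inr.inl.inr => exact absurd ⟨x, rfl⟩ hx
      all_goals rfl
    simp only [h1, toggle_apply, h2]
    simp

theorem countStage_run (s : ℕ) (r c : Fin n → Bool) (p : Bool) :
    run (countStage n) (inputBits n s r c p) = countBits n s (dotBits n r c) r c p := by
  have key : ∀ (l : List (Fin n)) (v : ℕ), run (l.flatMap fun i => [andGate n i] ++
      ctrlIncr (andQubit n) (vol n) (vol_ne_andQubit n) ++ [andGate n i])
      (countBits n s v r c p) =
      countBits n s (v + (l.map fun i => (r i).toNat * (c i).toNat).sum) r c p := by
    intro l
    induction l with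
    | nil => intro v; simp
    | cons i l ih =>
      intro v
      have h1 : ∀ w, allOn (andGate n i).controls (countBits n s w r c p) = (r i && c i) := by
        intro w
        simp [allOn, andGate, countBits, inputBits, row, col]
      have h2 : ∀ w, mcx (andGate n i).controls (andGate n i).target (countBits n s w r c p) =
          toggle (andQubit n) (r i && c i) (countBits n s w r c p) := fun w => by
        rw [mcx, h1]; rfl
      have h3 : ∀ w, mcx (andGate n i).controls (andGate n i).target
          (toggle (andQubit n) (r i && c i) (countBits n s w r c p)) = countBits n s w r c p :=
        fun w => by rw [← h2, mcx_mcx (andGate n i).target_notMem]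
      rw [List.flatMap_cons, run_append, run_append, run_append, run_cons, run_nil, run_cons,
        run_nil, h2, ctrlIncr_run_countBits, h3, ih, List.map_cons, List.sum_cons, ← add_assoc]
      congr 3
      cases r i <;> cases c i <;> rfl
  rw [← countBits_zero, countStage, key, dotBits, Fin.sum_univ_def, zero_add]

theorem uncountStage_eq : uncountStage n = (countStage n).reverse := by
  rw [countStage, List.reverse_flatMap, uncountStage]
  congr 1
  funext i
  simp [ctrlDecr]

theorem compareStage_run_par (x : OracleQubit n → Bool) (j : Fin (regSize n)) :
    run (compareStage n) x (par n j) = (x (par n j) ^^ x (vol n j)) := by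
  rw [run_apply_of_pairwise]
  · congr 1
    simp only [compareStage, List.mem_map, exists_exists_and_eq_and]
    simp [cxGate, allOn]
  · rw [compareStage, List.pairwise_map, List.pairwise_reverse]
    refine (List.pairwise_lt_finRange _).imp fun {i j} hij => ⟨?_, ?_⟩
    · simp [cxGate, par_apply, vol_apply]
    · simpa [cxGate] using hij.ne'

theorem flipPar_run (x : OracleQubit n → Bool) (q : OracleQubit n) :
    run (flipPar n) x q = (x q ^^ decide (∃ j, par n j = q)) := by
  rw [run_apply_of_pairwise]
  · congr 2
    simp [flipPar, xGate, allOn]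
  · rw [flipPar, List.pairwise_map]
    refine (List.pairwise_lt_finRange _).imp fun {i j} hij => ⟨?_, ?_⟩
    · simp [xGate]
    · simpa [xGate] using hij.ne

theorem phaseQubit_notMem_flipPar : ∀ g ∈ flipPar n, phaseQubit n ∉ g.controls := by
  simp [flipPar, xGate]

theorem markStage_run (x : OracleQubit n → Bool) :
    run (markStage n) x = toggle (phaseQubit n) (decide (∀ j, x (par n j) = false)) x := by
  rw [markStage, run_append, run_append, run_cons, run_nil, mcx,
    run_toggle (phaseQubit_notMem_flipPar n)]
  congr 1
  · simp [allOn, flipPar_run]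
  · ext q
    rw [flipPar_run, flipPar_run, Bool.xor_assoc, Bool.xor_self, Bool.xor_false]

theorem oracleCircuit_run (s : ℕ) (hs : s < 2 ^ regSize n) (r c : Fin n → Bool)
    (p : Bool) : run (oracleCircuit n) (inputBits n s r c p) =
      inputBits n s r c (p ^^ decide (dotBits n r c = s)) := by
  -- Since r·c ≤ n fits into the register, agreement on its bits means equality with `s`.
  have hdot : dotBits n r c < 2 ^ regSize n := by
    have h1 : dotBits n r c ≤ n := by
      refine (Finset.sum_le_card_nsmul _ _ 1 fun i _ => ?_).trans (by simp)
      cases r i <;> cases c i <;> simp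
    refine h1.trans_lt ?_
    rw [regSize, add_comm]
    exact Nat.lt_pow_succ_log_self (by norm_num) n
  -- The marking amounts to a flip of the phase qubit, which passes through the final gates, so
  -- these cancel the initial ones.
  have hrev : (compareStage n).reverse ++ uncountStage n =
      (countStage n ++ compareStage n).reverse := by
    rw [uncountStage_eq, List.reverse_append]
  have hphase : ∀ g ∈ (countStage n ++ compareStage n).reverse, phaseQubit n ∉ g.controls := by
    simp only [List.mem_reverse, List.mem_append, countStage, compareStage, List.mem_flatMap,
      List.mem_map, ctrlIncr, List.mem_singleton]
    rintro g (⟨i, -, ((rfl | ⟨j, -, rfl⟩) | rfl)⟩ | ⟨j, -, rfl⟩) <;>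
      simp [andGate, cxGate, phaseQubit, row, col, andQubit, vol_apply]
  rw [oracleCircuit, List.append_assoc, hrev, run_append, run_append, markStage_run,
    run_toggle hphase, run_reverse_run]
  have hiff : (∀ j, run (countStage n ++ compareStage n) (inputBits n s r c p) (par n j) = false) ↔
      dotBits n r c = s := by
    simp only [run_append, countStage_run, compareStage_run_par]
    have h1 : ∀ j, (countBits n s (dotBits n r c) r c p (par n j) ^^
        countBits n s (dotBits n r c) r c p (vol n j)) =
        (s.testBit j ^^ (dotBits n r c).testBit j) := fun _ => rfl
    simp only [h1, bne_eq_false_iff_eq]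
    constructor
    · intro h
      exact (eq_of_testBit_eq_of_lt hs hdot fun j hj => h ⟨j, hj⟩).symm
    · intro h j
      rw [h]
  simp only [hiff]
  ext x
  rw [toggle_apply]
  rcases x with (x | x) | ((x | x) | (x | x)) <;> simp [inputBits, phaseQubit]

theorem oracleCircuit_mulVec_inputState (k : ℕ) (hk : k + 2 < 2 ^ regSize n)
    (r c : Fin n → Bool) :
    (circuitMatrix MCX.matrix (oracleCircuit n)).mulVec (inputState n k r c) =
      (if dotBits n r c = k + 2 then (-1 : ℂ) else 1) • inputState n k r c := by
  rw [circuitMatrix_run, inputState, Matrix.mulVec_smul, Matrix.mulVec_sub, mapMatrix_mulVec_ket,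
    mapMatrix_mulVec_ket, oracleCircuit_run n _ hk, oracleCircuit_run n _ hk, smul_comm]
  congr 1
  split_ifs with h <;> simp [h]

end Oracle

/-! ### Counting gates and the asymptotic bound -/

section DepthBound

theorem oracleCircuit_length (n : ℕ) :
    (oracleCircuit n).length = 2 * (n * (regSize n + 2)) + (4 * regSize n + 1) := by
  simp [oracleCircuit, countStage, uncountStage, compareStage, markStage, flipPar, ctrlIncr,
    ctrlDecr, List.length_flatMap]
  ring

/-- In the first case nothing has to be borrowed; in the second all 2n data qubits are available. -/
theorem card_controls_of_mem_oracleCircuit {n : ℕ} {g : MCX (OracleQubit n)}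
    (hg : g ∈ oracleCircuit n) : g.controls.card ≤ 2 ∨ (g.controls.card ≤ regSize n ∧
      ∀ d : DataQubit n, Sum.inl d ∉ insert g.target g.controls) := by
  have hinc : ∀ g ∈ ctrlIncr (andQubit n) (vol n) (vol_ne_andQubit n),
      (g.controls.card ≤ regSize n ∧
        ∀ d : DataQubit n, Sum.inl d ∉ insert g.target g.controls) := by
    intro g hg
    obtain ⟨i, -, rfl⟩ := List.mem_map.1 hg
    refine ⟨(Finset.card_insert_le _ _).trans ?_, ?_⟩
    · rw [Finset.card_map, show (Finset.univ.filter fun j => j < i) = Finset.Iio i by ext; simp, Fin.card_Iio]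
      exact i.2
    · simp [vol_apply, andQubit]
  have hcount : g ∈ countStage n → g.controls.card ≤ 2 ∨ (g.controls.card ≤ regSize n ∧
      ∀ d : DataQubit n, Sum.inl d ∉ insert g.target g.controls) := by
    intro hg
    obtain ⟨i, -, hg⟩ := List.mem_flatMap.1 hg
    simp only [List.mem_append, List.mem_singleton] at hg
    rcases hg with (rfl | hg) | rfl
    exacts [.inl Finset.card_le_two, .inr (hinc g hg), .inl Finset.card_le_two]
  have hcompare : g ∈ compareStage n → g.controls.card ≤ 2 := by
    intro hg
    obtain ⟨j, -, rfl⟩ := List.mem_map.1 hg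
    simp [cxGate]
  have hflip : g ∈ flipPar n → g.controls.card ≤ 2 := by
    intro hg
    obtain ⟨j, -, rfl⟩ := List.mem_map.1 hg
    simp [xGate]
  simp only [oracleCircuit, markStage, uncountStage_eq, List.mem_append, List.mem_reverse,
    List.mem_singleton] at hg
  rcases hg with (((hg | hg) | ((hg | rfl) | hg)) | hg) | hg
  · exact hcount hg
  · exact .inl (hcompare hg)
  · exact .inl (hflip hg)
  · refine .inr ⟨by simp, ?_⟩
    simp [phaseQubit, par_apply]
  · exact .inl (hflip hg)
  · exact .inl (hcompare hg)
  · exact hcount hg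

/-- An exponent `j` for which `2 ^ 2 ^ j` is at least the number of controls of every gate. -/
def recursionDepth (n : ℕ) : ℕ := Nat.clog 2 (Nat.clog 2 (regSize n))

theorem regSize_le (n : ℕ) : regSize n ≤ 2 ^ 2 ^ recursionDepth n :=
  (Nat.le_pow_clog (by norm_num) _).trans
    (Nat.pow_le_pow_right (by norm_num) (Nat.le_pow_clog (by norm_num) _))

/-- The factor 2 is needed at `L = 3`, and having 2n rather than n data qubits pays for it. -/
theorem sq_le_two_mul_two_pow (L : ℕ) : L ^ 2 ≤ 2 * 2 ^ L := by
  induction L with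
  | zero => simp
  | succ L ih =>
    rcases lt_or_ge L 3 with h | h
    · interval_cases L <;> norm_num
    · rw [pow_succ 2 L]; nlinarith

/-- Rounding the exponent up at most squares a number below `regSize n`, and log² n is still within
the supply of borrowed qubits. -/
theorem two_pow_two_pow_recursionDepth_le {n : ℕ} (hn : 0 < n) :
    2 ^ 2 ^ recursionDepth n ≤ 2 * n := by
  rcases hj : recursionDepth n with _ | j
  · simp; omega
  · have h1 : 2 ^ j < Nat.clog 2 (regSize n) :=
      (Nat.lt_clog_iff_pow_lt (by norm_num)).1 (by rw [← recursionDepth, hj]; omega)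
    have h2 : 2 ^ 2 ^ j < regSize n := (Nat.lt_clog_iff_pow_lt (by norm_num)).1 h1
    have h3 : 2 ^ 2 ^ j ≤ Nat.log 2 n := by unfold regSize at h2; omega
    rw [pow_succ 2 j, pow_mul]
    calc (2 ^ 2 ^ j) ^ 2 ≤ Nat.log 2 n ^ 2 := Nat.pow_le_pow_left h3 2
      _ ≤ 2 * 2 ^ Nat.log 2 n := sq_le_two_mul_two_pow _
      _ ≤ 2 * n := Nat.mul_le_mul_left _ (Nat.pow_log_le_self 2 hn.ne')

theorem implements_of_mem_oracleCircuit {n : ℕ} (hn : 0 < n) {g : MCX (OracleQubit n)}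
    (hg : g ∈ oracleCircuit n) :
    Implements Finset.univ (18 * 8 ^ recursionDepth n) g.matrix := by
  have h8 : 1 ≤ 8 ^ recursionDepth n := Nat.one_le_pow _ _ (by norm_num)
  rw [MCX.matrix_eq]
  rcases card_controls_of_mem_oracleCircuit hg with h | ⟨h, hd⟩
  · exact (implements_mcx_of_card_le_two g.target_notMem h).mono (Finset.subset_univ _) (by omega)
  · refine (implements_mcx (recursionDepth n) g.controls
      ((Finset.univ : Finset (DataQubit n)).map Function.Embedding.inl) g.target
      g.target_notMem ?_ ?_ (h.trans (regSize_le n)) ?_).mono (Finset.subset_univ _) (by omega)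
    · intro ht
      obtain ⟨d, -, hd'⟩ := Finset.mem_map.1 ht
      exact hd d (Finset.mem_insert.2 (.inl hd'))
    · rw [Finset.disjoint_right]
      intro p hp hp'
      obtain ⟨d, -, rfl⟩ := Finset.mem_map.1 hp
      exact hd d (Finset.mem_insert_of_mem hp')
    · rw [Finset.card_map, Finset.card_univ, Fintype.card_sum, Fintype.card_fin, ← two_mul]
      exact two_pow_two_pow_recursionDepth_le hn

theorem depthBound_le {n : ℕ} (hn : 2 ≤ n) (hLL : 1 ≤ Real.log (Real.log n)) :
    (((oracleCircuit n).length * (18 * 8 ^ recursionDepth n) : ℕ) : ℝ) ≤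
      (17 * 2 * 18 * 8 * 5 ^ 3) * (n * Real.log n * Real.log (Real.log n) ^ 3) := by
  set L := Nat.log 2 n with hL
  set m := Nat.clog 2 (regSize n) with hm
  have hL1 : 1 ≤ L := Nat.log_pos (by norm_num) hn
  -- The length is 2nL + 6n + 4L + 5, and 2 + 6 + 4 + 5 = 17.
  have hlen : (oracleCircuit n).length ≤ 17 * (n * L) := by
    rw [oracleCircuit_length, regSize, ← hL]
    nlinarith [Nat.mul_le_mul hn hL1, Nat.mul_le_mul_left n hL1]
  have hm1 : 1 ≤ m := Nat.clog_pos (by norm_num) (by unfold regSize; omega)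
  have h8 : 8 ^ recursionDepth n ≤ 8 * m ^ 3 := by
    have h2 : 2 ^ recursionDepth n ≤ 2 * m := by
      rcases hj : recursionDepth n with _ | j
      · simp; omega
      · have h1 : 2 ^ j < m :=
          (Nat.lt_clog_iff_pow_lt (by norm_num)).1 (by rw [hm, ← recursionDepth, hj]; omega)
        rw [pow_succ]; omega
    calc 8 ^ recursionDepth n = (2 ^ recursionDepth n) ^ 3 := by
          rw [← pow_mul, mul_comm, pow_mul]; norm_num
      _ ≤ (2 * m) ^ 3 := Nat.pow_le_pow_left h2 3
      _ = 8 * m ^ 3 := by ring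
  have hlog2 : (1 / 2 : ℝ) < Real.log 2 := by linarith [Real.log_two_gt_d9]
  have hn0 : (0 : ℝ) < n := by positivity
  have hLlog : (L : ℝ) * Real.log 2 ≤ Real.log n := by
    rw [← Real.log_pow]
    refine Real.log_le_log (by positivity) ?_
    exact_mod_cast Nat.pow_log_le_self 2 (by omega)
  have hL0 : (0 : ℝ) ≤ L := by positivity
  have hL2 : (L : ℝ) ≤ 2 * Real.log n := by nlinarith
  have hlogpos : 0 < Real.log n := by
    have : (1 : ℝ) ≤ L := by exact_mod_cast hL1
    nlinarith
  -- From 2 ^ (m - 1) ≤ 2 log n follows m ≤ 2 + (log log n) / log 2. As log 2 > 1/2 and log log n ≥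
  -- 1, even the factor 4 would do.
  have hm2 : (m : ℝ) ≤ 5 * Real.log (Real.log n) := by
    have h1 : 2 ^ (m - 1) < regSize n := (Nat.lt_clog_iff_pow_lt (by norm_num)).1 (by omega)
    have h2 : 2 ^ (m - 1) ≤ L := by unfold regSize at h1; omega
    have h3 : (2 : ℝ) ^ (m - 1) ≤ 2 * Real.log n := by
      refine le_trans ?_ hL2
      exact_mod_cast h2
    have h4 := Real.log_le_log (by positivity) h3
    rw [Real.log_pow, Real.log_mul (by norm_num) hlogpos.ne', Nat.cast_sub hm1] at h4
    push_cast at h4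
    nlinarith
  push_cast
  calc ((oracleCircuit n).length : ℝ) * (18 * 8 ^ recursionDepth n)
      ≤ (17 * (n * L)) * (18 * (8 * m ^ 3)) := by
        gcongr
        · exact_mod_cast hlen
        · exact_mod_cast h8
    _ ≤ (17 * (n * (2 * Real.log n))) * (18 * (8 * (5 * Real.log (Real.log n)) ^ 3)) := by
        gcongr
    _ = _ := by ring

end DepthBound

end BDOracle

theorem mainTheorem3 :
    -- number of ancilla qubits and total width
    (∀ n : ℕ, 0 < n →
      Fintype.card (AncillaQubit n) = 2 * (Nat.log 2 n + 2) ∧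
      Fintype.card (OracleQubit n) = 2 * (n + Nat.log 2 n + 2)) ∧
    -- the circuit marks the pairs with dot product `k + 2` by a phase and restores all ancillas
    (∀ n k : ℕ, 0 < n → k + 2 < 2 ^ regSize n → ∀ r c : Fin n → Bool,
      (circuitMatrix MCX.matrix (oracleCircuit n)).mulVec (inputState n k r c) =
        (if dotBits n r c = k + 2 then (-1 : ℂ) else 1) • inputState n k r c) ∧
    -- its depth in single-qubit and CNOT gates, without any further qubits
    (∃ W : (n : ℕ) → List (PrimGate (OracleQubit n)),
      (∀ n : ℕ, 0 < n → IsDecomposition (W n) (oracleCircuit n)) ∧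
      (fun n : ℕ => (depth (W n) : ℝ)) =O[atTop]
        fun n : ℕ => (n : ℝ) * Real.log n * Real.log (Real.log n) ^ 3) := by
  refine ⟨fun n _ => ?_, fun n k _ hk r c => oracleCircuit_mulVec_inputState n k hk r c, ?_⟩
  · simp only [Fintype.card_sum, Fintype.card_fin, Fintype.card_unit, regSize]
    omega
  have hex : ∀ n : ℕ, ∃ W : List (PrimGate (OracleQubit n)), 0 < n →
      IsDecomposition W (oracleCircuit n) ∧
        depth W ≤ (oracleCircuit n).length * (18 * 8 ^ recursionDepth n) := by
    intro n
    rcases Nat.eq_zero_or_pos n with h | h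
    · exact ⟨[], fun h' => absurd h h'.ne'⟩
    · obtain ⟨W, hW⟩ := exists_decomposition fun g hg => implements_of_mem_oracleCircuit h hg
      exact ⟨W, fun _ => hW⟩
  choose W hW using hex
  refine ⟨W, fun n hn => (hW n hn).1, IsBigO.of_bound (17 * 2 * 18 * 8 * 5 ^ 3) ?_⟩
  have hlim : Tendsto (fun n : ℕ => Real.log (Real.log n)) atTop atTop :=
    Real.tendsto_log_atTop.comp (Real.tendsto_log_atTop.comp tendsto_natCast_atTop_atTop)
  filter_upwards [hlim.eventually_ge_atTop 1, eventually_ge_atTop 2] with n hLL hn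
  rw [Real.norm_of_nonneg (by positivity)]
  refine le_trans ?_ (mul_le_mul_of_nonneg_left (le_abs_self _) (by norm_num))
  exact (Nat.cast_le.2 (hW n (by omega)).2).trans (depthBound_le hn hLL)
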